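/- All graphs are finite, simple and undirected. A graph is chordal if every induced cycle is a triangle. The tree-width $\mathrm{tw}(G)$ is the minimum integer $t$ such that $G$ is a subgraph of a chordal graph with no clique on $t+2$ vertices. Given a partition of $V(G)$ into bags, let its quotient graph be the graph whose vertices are the bags, two distinct bags being adjacent if and only if some edge of $G$ joins them. The partition is a tree-partition of $G$ if its quotient graph is a forest, and its width is the maximum number of vertices in a bag. The tree-partition-width $\mathrm{tpw}(G)$ is the minimum width of a tree-partition of $G$. Write $\Delta(G)$ for the maximum degree of $G$. For positive integers $n,k$ and an integer $m\ge 0$, let $H_{n,k}$ be the graph with vertex set $\{1,\dots,n\}\times\{1,\dots,k\}$ in which distinct vertices $(x_1,y_1)$ and $(x_2,y_2)$ are adjacent if and only if $|x_1-x_2|\le 1$, and let $G_{n,k,m}$ be obtained from $H_{n,k}$ by adding, for each horizontal edge (an edge joining $(x,y)$ and $(x+1,y)$), $m$ new vertices, each adjacent exactly to the two endpoints of that edge. **Lemma.** For all integers $k\ge 2$ and $\Delta\ge 3k+1$, for infinitely many integers $N$, there is a chordal graph $G$ with $N$ vertices, tree-width $\mathrm{tw}(G)=2k-1$, maximum degree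 $\Delta(G)\le\Delta$, and tree-partition-width $$\mathrm{tpw}(G)>\tfrac14\,k(\Delta-3k).$$ Moreover, $G$ can be taken to be isomorphic to $G_{n,k,m}$ with $m=\lceil(\Delta-3k)/2\rceil$ for some integer $n$. -/

import Mathlib

namespace TreePartition

/-- A graph is chordal if every induced cycle is a triangle. -/
def IsChordal {V : Type*} (G : SimpleGraph V) : Prop :=
  ∀ n : ℕ, 3 ≤ n → Nonempty (SimpleGraph.cycleGraph n ↪g G) → n = 3

/-- The tree-width of a finite graph: the minimum `t` such that `G` is a subgraph of a
(finite) chordal graph with no clique on `t + 2` vertices. -/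
noncomputable def treewidth {V : Type*} [Finite V] (G : SimpleGraph V) : ℕ :=
  sInf {t : ℕ | ∃ (m : ℕ) (H : SimpleGraph (Fin m)),
    G.IsContained H ∧ IsChordal H ∧ H.CliqueFree (t + 2)}

/-- The graph whose vertices are the bags of a partition `P` of the vertex set of `G`, where
distinct bags are adjacent iff some edge of `G` joins a vertex of one to a vertex of the other. -/
def quotientGraph {V : Type*} [Fintype V] [DecidableEq V] (G : SimpleGraph V)
    (P : Finpartition (Finset.univ : Finset V)) : SimpleGraph {B : Finset V // B ∈ P.parts} where
  Adj A B := A ≠ B ∧ ∃ a ∈ A.1, ∃ b ∈ B.1, G.Adj a b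
  symm := ⟨fun _ _ h => by
    obtain ⟨hne, a, ha, b, hb, hab⟩ := h
    exact ⟨hne.symm, b, hb, a, ha, hab.symm⟩⟩
  loopless := ⟨fun _ h => h.1 rfl⟩

/-- A partition is a tree-partition if its graph of bags is a forest. -/
def IsTreePartition {V : Type*} [Fintype V] [DecidableEq V] (G : SimpleGraph V)
    (P : Finpartition (Finset.univ : Finset V)) : Prop :=
  (quotientGraph G P).IsAcyclic

/-- The width of a partition: the maximum number of vertices in a bag. -/
def width {V : Type*} [Fintype V] [DecidableEq V]
    (P : Finpartition (Finset.univ : Finset V)) : ℕ :=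
  P.parts.sup Finset.card

/-- The tree-partition-width: the minimum width of a tree-partition. -/
noncomputable def treePartitionWidth {V : Type*} [Fintype V] [DecidableEq V]
    (G : SimpleGraph V) : ℕ :=
  sInf {w : ℕ | ∃ P : Finpartition (Finset.univ : Finset V), IsTreePartition G P ∧ width P = w}

/-- The thick path with `n` columns and `k` rows: distinct vertices `(x₁, y₁)`, `(x₂, y₂)` are
adjacent iff `|x₁ - x₂| ≤ 1`. -/
def thickPath (n k : ℕ) : SimpleGraph (Fin n × Fin k) where
  Adj p q := p ≠ q ∧ p.1.val ≤ q.1.val + 1 ∧ q.1.val ≤ p.1.val + 1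
  symm := ⟨fun _ _ h => ⟨h.1.symm, h.2.2, h.2.1⟩⟩
  loopless := ⟨fun _ h => h.1 rfl⟩

/-- Adjacency between a vertex of the thick path and a new vertex `(x, y, j)`, the `j`-th one
attached to the horizontal edge that joins `(x, y)` and `(x + 1, y)`. -/
def attachedTo {n k m : ℕ} (p : Fin n × Fin k) (e : Fin (n - 1) × Fin k × Fin m) : Prop :=
  p.2 = e.2.1 ∧ (p.1.val = e.1.val ∨ p.1.val = e.1.val + 1)

/-- The thick path with `n` columns and `k` rows, with `m` new vertices added for each horizontal
edge `vw` (an edge joining `(x, y)` and `(x + 1, y)`), each adjacent to exactly `v` and `w`. -/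
def decoratedThickPath (n k m : ℕ) :
    SimpleGraph ((Fin n × Fin k) ⊕ (Fin (n - 1) × Fin k × Fin m)) where
  Adj a b := match a, b with
    | Sum.inl p, Sum.inl q => (thickPath n k).Adj p q
    | Sum.inl p, Sum.inr e => attachedTo p e
    | Sum.inr e, Sum.inl p => attachedTo p e
    | Sum.inr _, Sum.inr _ => False
  symm := ⟨fun a b h => by
    rcases a with p | e <;> rcases b with q | f
    · exact (thickPath n k).symm.symm _ _ h
    · exact h
    · exact h
    · exact h⟩
  loopless := ⟨fun a h => by
    rcases a with p | e
    · exact (thickPath n k).loopless.irrefl _ h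
    · exact h⟩

end TreePartition

namespace TreePartition

open Finset

/-! A forest has no triangle, so in a tree-partition each triangle of `G` has two vertices in one
bag. Hence two consecutive columns, being a clique, meet at most two bags. If the width `w` is below
`n`, no bag meets every column, and this forces two bags `A ≠ B` such that every row has a
horizontal edge with one end in each (`exists_crossing`). The `m` vertices attached to that edge
then lie in `A ∪ B`; adding one end of the edge per row gives `k * (m + 1) ≤ 2 * w`.

Chordality comes from simplicial vertices, and tree-width from the clique number. -/

/-! ### Chordality. -/

/-- A graph is chordal if every nonempty set of vertices contains a vertex that is simplicial in
the subgraph it induces. -/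
theorem isChordal_of_exists_simplicial {V : Type*} {G : SimpleGraph V}
    (h : ∀ s : Finset V, s.Nonempty →
      ∃ v ∈ s, ∀ a ∈ s, ∀ b ∈ s, G.Adj v a → G.Adj v b → a ≠ b → G.Adj a b) :
    IsChordal G := by
  rintro n hn ⟨c⟩
  obtain ⟨n, rfl⟩ : ∃ r, n = r + 3 := ⟨n - 3, by omega⟩
  obtain ⟨v, hv, hs⟩ := h (univ.map c.toEmbedding) (by simp)
  obtain ⟨i, -, rfl⟩ := mem_map.1 hv
  have h1 : (SimpleGraph.cycleGraph (n + 3)).Adj i (i + 1) := by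
    rw [SimpleGraph.cycleGraph_adj]; right; abel
  have h2 : (SimpleGraph.cycleGraph (n + 3)).Adj i (i - 1) := by
    rw [SimpleGraph.cycleGraph_adj]; left; abel
  have hval : ((1 : Fin (n + 3)) + 1).val = 2 := by
    rw [Fin.val_add, Fin.val_one, Nat.mod_eq_of_lt (by omega)]
  have hdiff : (i + 1) - (i - 1) = 1 + 1 := by abel
  have hdiff' : (i - 1) - (i + 1) = -(1 + 1) := by abel
  have hne : i + 1 ≠ i - 1 := by
    intro he
    rw [← sub_eq_zero, hdiff] at he
    rw [he] at hval
    simp at hval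
  -- The cycle-neighbours of a simplicial vertex are adjacent, so `2 = ±1` modulo the length, which
  -- leaves only length 3.
  have h3 := hs (c (i + 1)) (mem_map_of_mem _ (mem_univ _)) (c (i - 1))
    (mem_map_of_mem _ (mem_univ _)) (c.map_rel_iff.2 h1) (c.map_rel_iff.2 h2)
    (fun he => hne (c.injective he))
  have h4 := c.map_rel_iff.1 h3
  rw [SimpleGraph.cycleGraph_adj, hdiff, hdiff'] at h4
  rcases h4 with h4 | h4
  · rw [h4] at hval
    simp at hval
  · have h5 : ((1 : Fin (n + 3)) + 1) + 1 = 0 := neg_eq_iff_add_eq_zero.1 h4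
    have h6 := congrArg Fin.val h5
    rw [Fin.val_add, hval, Fin.val_one, Fin.val_zero] at h6
    have := Nat.le_of_dvd (by norm_num) (Nat.dvd_of_mod_eq_zero h6)
    omega

theorem IsChordal.of_embedding {V W : Type*} {G : SimpleGraph V} {H : SimpleGraph W}
    (hH : IsChordal H) (e : G ↪g H) : IsChordal G :=
  fun n hn ⟨c⟩ => hH n hn ⟨e.comp c⟩

/-- A new vertex is simplicial. Without new vertices, take a leftmost vertex: its neighbours lie in
its own column and the next, which form a clique. -/
theorem isChordal_decoratedThickPath (n k m : ℕ) : IsChordal (decoratedThickPath n k m) := by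
  refine isChordal_of_exists_simplicial fun s hs => ?_
  by_cases hr : ∃ e, Sum.inr e ∈ s
  · obtain ⟨e, he⟩ := hr
    refine ⟨_, he, ?_⟩
    rintro (⟨x, y⟩ | a) - (⟨x', y'⟩ | b) - ha hb hne
    · simp only [decoratedThickPath, attachedTo] at ha hb
      refine ⟨fun h => hne (congrArg _ h), ?_, ?_⟩ <;> dsimp only <;> omega
    · exact hb.elim
    · exact ha.elim
    · exact ha.elim
  · push Not at hr
    obtain ⟨v, hv, hmin⟩ := s.exists_min_image
      (Sum.elim (fun p => p.1.val) (fun _ => 0)) hs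
    refine ⟨v, hv, ?_⟩
    rintro (⟨x, y⟩ | a) ha' (⟨x', y'⟩ | b) hb' ha hb hne
    · rcases v with p | e
      · have h1 := hmin _ ha'
        have h2 := hmin _ hb'
        have h3 := ha.2
        have h4 := hb.2
        simp only [Sum.elim_inl] at h1 h2 h3 h4
        refine ⟨fun h => hne (congrArg _ h), ?_, ?_⟩ <;> dsimp only <;> omega
      · exact (hr e hv).elim
    · exact (hr b hb').elim
    · exact (hr a ha').elim
    · exact (hr a ha').elim

/-! ### Clique number and tree-width. -/

/-- A set of vertices of the thick path lying in two consecutive columns has at most `2k`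
elements. -/
theorem card_le_of_two_columns {n k x : ℕ} (s : Finset (Fin n × Fin k))
    (hs : ∀ p ∈ s, x ≤ p.1.val ∧ p.1.val ≤ x + 1) : #s ≤ 2 * k := by
  have h := card_le_card_of_injOn (s := s) (t := Finset.range 2 ×ˢ (univ : Finset (Fin k)))
    (fun p => (p.1.val - x, p.2))
    (fun p hp => by have := hs p hp; simp; omega)
    (by
      rintro ⟨a, b⟩ hp ⟨a', b'⟩ hq heq
      have h1 := hs _ hp
      have h2 := hs _ hq
      simp only [Prod.mk.injEq, Fin.ext_iff] at heq h1 h2 ⊢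
      omega)
  simpa using h

/-- A clique with a new vertex has at most three elements, fewer than `2 * k + 1` as `k ≥ 2`; any
other clique lies in two consecutive columns. -/
theorem cliqueFree_decoratedThickPath {n k m : ℕ} (hk : 2 ≤ k) :
    (decoratedThickPath n k m).CliqueFree (2 * k + 1) := by
  intro s hs
  have hcl : ∀ a ∈ s, ∀ b ∈ s, a ≠ b → (decoratedThickPath n k m).Adj a b :=
    fun a ha b hb hab => hs.1 ha hb hab
  have hcard : #s.toLeft + #s.toRight = 2 * k + 1 := by
    rw [card_toLeft_add_card_toRight, hs.2]
  by_cases hr : ∃ e, Sum.inr e ∈ s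
  · obtain ⟨⟨e, y, j⟩, he⟩ := hr
    have h1 : #s.toRight ≤ 1 := by
      refine card_le_one.2 fun a ha b hb => ?_
      by_contra hab
      exact hcl _ (mem_toRight.1 ha) _ (mem_toRight.1 hb) (by simpa using hab)
    have h2 : #s.toLeft ≤ 2 := by
      have h := card_le_card_of_injOn (s := s.toLeft) (t := Finset.range 2)
        (fun p => p.1.val - e.val)
        (fun p hp => by
          obtain ⟨-, h⟩ := hcl _ (mem_toLeft.1 hp) _ he (by simp)
          simp only [coe_range, Set.mem_Iio] at h ⊢
          omega)
        (by
          rintro ⟨a, b⟩ hp ⟨a', b'⟩ hq heq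
          have h1 := hcl _ (mem_toLeft.1 hp) _ he (by simp)
          have h2 := hcl _ (mem_toLeft.1 hq) _ he (by simp)
          simp only [decoratedThickPath, attachedTo] at h1 h2 heq
          simp only [Prod.mk.injEq, Fin.ext_iff] at *
          omega)
      simpa using h
    omega
  · have h1 : s.toRight = ∅ := by
      ext e
      simpa using fun he => hr ⟨e, he⟩
    have h2 : s.toLeft.Nonempty := by
      rw [← card_pos]
      simp only [h1, card_empty] at hcard
      omega
    obtain ⟨v, hv, hmin⟩ := s.toLeft.exists_min_image (fun p => p.1.val) h2
    have h3 := card_le_of_two_columns (x := v.1.val) s.toLeft fun p hp => by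
      refine ⟨hmin p hp, ?_⟩
      by_cases hpv : p = v
      · subst hpv; omega
      · exact (hcl _ (mem_toLeft.1 hp) _ (mem_toLeft.1 hv) (by simpa using hpv)).2.1
    simp only [h1, card_empty] at hcard
    omega

theorem not_cliqueFree_decoratedThickPath {n k m : ℕ} (hn : 2 ≤ n) :
    ¬ (decoratedThickPath n k m).CliqueFree (2 * k) := by
  intro h
  refine h ((univ ×ˢ univ : Finset (Fin 2 × Fin k)).map
    ⟨fun p => Sum.inl (Fin.castLE hn p.1, p.2), ?_⟩) ⟨?_, by simp⟩
  · rintro ⟨a, b⟩ ⟨a', b'⟩ heq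
    simpa using heq
  · intro a ha b hb hab
    simp only [coe_map, Set.mem_image] at ha hb
    obtain ⟨⟨x, y⟩, -, rfl⟩ := ha
    obtain ⟨⟨x', y'⟩, -, rfl⟩ := hb
    refine ⟨fun h => hab (congrArg Sum.inl h), ?_, ?_⟩
    · simp only [Fin.val_castLE]; omega
    · simp only [Fin.val_castLE]; omega

/-- A chordal graph of clique number `ω` has tree-width `ω - 1`. -/
theorem treewidth_eq_of_isChordal {N r : ℕ} {G : SimpleGraph (Fin N)} (hG : IsChordal G)
    (hfree : G.CliqueFree (r + 2)) (hclique : ¬ G.CliqueFree (r + 1)) : treewidth G = r := by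
  refine le_antisymm (Nat.sInf_le ⟨N, G, .rfl, hG, hfree⟩) (le_csInf ⟨r, N, G, .rfl, hG, hfree⟩ ?_)
  rintro t ⟨M, H, hGH, -, hH⟩
  by_contra hlt
  exact hclique ((hH.comap hGH).mono (by omega))

/-! ### Maximum degree. -/

theorem degree_decoratedThickPath_le {n k m : ℕ} (hk : 1 ≤ k)
    (v : (Fin n × Fin k) ⊕ (Fin (n - 1) × Fin k × Fin m))
    [Fintype ((decoratedThickPath n k m).neighborSet v)] :
    (decoratedThickPath n k m).degree v ≤ 3 * k - 1 + 2 * m := by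
  classical
  rcases v with ⟨x, y⟩ | ⟨x, y, j⟩
  · have h := card_le_card_of_injOn
      (s := insert (Sum.inl (x, y)) ((decoratedThickPath n k m).neighborFinset (Sum.inl (x, y))))
      (t := (Finset.range 3 ×ˢ (univ : Finset (Fin k))).disjSum
        (Finset.range 2 ×ˢ (univ : Finset (Fin m))))
      -- The shift by one keeps the column offset injective under truncated subtraction.
      (Sum.map (fun p => (p.1.val + 1 - x.val, p.2)) (fun e => (e.1.val + 1 - x.val, e.2.2)))
      (by
        rintro (⟨x', y'⟩ | ⟨x', y', j'⟩) hp
        · have hx : x'.val ≤ x.val + 1 := by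
            rcases mem_insert.1 hp with hp | hp
            · simp only [Sum.inl.injEq, Prod.mk.injEq, Fin.ext_iff] at hp
              omega
            · exact ((SimpleGraph.mem_neighborFinset _ _ _).1 hp).2.2
          simp
          omega
        · have hx : x.val = x'.val ∨ x.val = x'.val + 1 := by
            rcases mem_insert.1 hp with hp | hp
            · simp at hp
            · exact ((SimpleGraph.mem_neighborFinset _ _ _).1 hp).2
          simp
          omega)
      (by
        have hl : ∀ p : Fin n × Fin k, Sum.inl p ∈ insert (Sum.inl (x, y))
            ((decoratedThickPath n k m).neighborFinset (Sum.inl (x, y))) →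
            x.val ≤ p.1.val + 1 := by
          intro p hp
          rcases mem_insert.1 hp with hp | hp
          · rw [Sum.inl.inj hp]; simp
          · exact ((SimpleGraph.mem_neighborFinset _ _ _).1 hp).2.1
        have hr : ∀ e : Fin (n - 1) × Fin k × Fin m, Sum.inr e ∈ insert (Sum.inl (x, y))
            ((decoratedThickPath n k m).neighborFinset (Sum.inl (x, y))) →
            y = e.2.1 ∧ (x.val = e.1.val ∨ x.val = e.1.val + 1) := by
          intro e hp
          rcases mem_insert.1 hp with hp | hp
          · simp at hp
          · exact (SimpleGraph.mem_neighborFinset _ _ _).1 hp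
        rintro (⟨a, b⟩ | ⟨a, b, c⟩) hp (⟨a', b'⟩ | ⟨a', b', c'⟩) hq heq
        · have h1 := hl _ hp
          have h2 := hl _ hq
          simp only [Sum.map_inl, Sum.inl.injEq, Prod.mk.injEq, Fin.ext_iff] at *
          omega
        · simp at heq
        · simp at heq
        · have h1 := hr _ hp
          have h2 := hr _ hq
          simp only [Sum.map_inr, Sum.inr.injEq, Prod.mk.injEq, Fin.ext_iff] at *
          omega)
    rw [card_insert_of_notMem (by simp), SimpleGraph.card_neighborFinset_eq_degree] at h
    simp at h
    omega
  · have h := card_le_card_of_injOn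
      (s := (decoratedThickPath n k m).neighborFinset (Sum.inr (x, y, j)))
      (t := Finset.range 2)
      (Sum.elim (fun p => p.1.val - x.val) (fun _ => 0))
      (by
        rintro (⟨x', y'⟩ | e) hp
        · have hx := ((SimpleGraph.mem_neighborFinset _ _ _).1 hp).2
          simp only [Sum.elim_inl, coe_range, Set.mem_Iio] at hx ⊢
          omega
        · simp)
      (by
        rintro (⟨a, b⟩ | e) hp (⟨a', b'⟩ | e') hq heq
        · have h1 : attachedTo _ _ := (SimpleGraph.mem_neighborFinset _ _ _).1 hp
          have h2 : attachedTo _ _ := (SimpleGraph.mem_neighborFinset _ _ _).1 hq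
          simp only [attachedTo, Sum.elim_inl, Sum.inl.injEq, Prod.mk.injEq, Fin.ext_iff] at *
          omega
        · exact ((SimpleGraph.mem_neighborFinset _ _ _).1 hq).elim
        · exact ((SimpleGraph.mem_neighborFinset _ _ _).1 hp).elim
        · exact ((SimpleGraph.mem_neighborFinset _ _ _).1 hp).elim)
    rw [SimpleGraph.card_neighborFinset_eq_degree, card_range] at h
    have : j.val < m := j.2
    omega

/-! ### Crossings in column colourings. -/

/-- In a colouring of the rows and columns with at most two colours on any two consecutive
columns, if some column has only the colour `A` and a later one avoids `A`, then some second
colour `B` directly follows `A` in every row. -/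
theorem exists_crossing_of_lt {ι β : Type*} (g : ℕ → ι → β)
    (hg : ∀ x₁ x₂ x₃ y₁ y₂ y₃, x₁ ≤ x₂ + 1 → x₂ ≤ x₁ + 1 → x₂ ≤ x₃ + 1 → x₃ ≤ x₂ + 1 →
      x₁ ≤ x₃ + 1 → x₃ ≤ x₁ + 1 →
      g x₁ y₁ = g x₂ y₂ ∨ g x₂ y₂ = g x₃ y₃ ∨ g x₁ y₁ = g x₃ y₃)
    {A : β} {x₀ x₁ : ℕ} (hlt : x₀ < x₁) (h₀ : ∀ y, g x₀ y = A) (h₁ : ∀ y, g x₁ y ≠ A)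
    (y₀ : ι) : ∃ B, A ≠ B ∧ ∀ y, ∃ z, g z y = A ∧ g (z + 1) y = B := by
  classical
  have hex : ∃ x, x₀ < x ∧ ∀ y, g x y ≠ A := ⟨x₁, hlt, h₁⟩
  -- The first column `X` past `x₀` that avoids `A`: its left neighbour contains `A`, so `X` has a
  -- single colour `B`.
  obtain ⟨hxlt, hx⟩ := Nat.find_spec hex
  have hmin : ∀ x, x₀ ≤ x → x < Nat.find hex → ∃ y, g x y = A := by
    intro x hx0 hxx
    rcases hx0.eq_or_lt with rfl | hx0
    · exact ⟨y₀, h₀ y₀⟩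
    · by_contra! hcon
      exact Nat.find_min hex hxx ⟨hx0, hcon⟩
  set X := Nat.find hex
  have hpure : ∀ y, g X y = g X y₀ := by
    intro y
    obtain ⟨y', hy'⟩ := hmin (X - 1) (by omega) (by omega)
    rcases hg (X - 1) X X y' y y₀ (by omega) (by omega) (by omega) (by omega) (by omega)
      (by omega) with h | h | h
    · exact (hx y (h.symm.trans hy')).elim
    · exact h
    · exact (hx y₀ (h.symm.trans hy')).elim
  refine ⟨g X y₀, fun h => hx y₀ h.symm, fun y => ?_⟩
  by_contra! hcon
  -- Going left from `X`, each column contains `A` and its right neighbour has `B` in row `y`.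
  -- Without a crossing the row would stay `B` down to `x₀`.
  have hall : ∀ d, d ≤ X - x₀ → g (X - d) y = g X y₀ := by
    intro d
    induction d with
    | zero => exact fun _ => hpure y
    | succ d ih =>
      intro hd
      have hB := ih (by omega)
      have hne : g (X - (d + 1)) y ≠ A := by
        intro hA
        refine hcon _ hA ?_
        rwa [show X - (d + 1) + 1 = X - d by omega]
      obtain ⟨y', hy'⟩ := hmin (X - (d + 1)) (by omega) (by omega)
      rcases hg (X - (d + 1)) (X - (d + 1)) (X - d) y y' y (by omega) (by omega) (by omega)
        (by omega) (by omega) (by omega) with h | h | h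
      · exact (hne (h.trans hy')).elim
      · exact (hx y₀ (by rw [← hB, ← h, hy'])).elim
      · exact h.trans hB
  have := hall (X - x₀) le_rfl
  rw [show X - (X - x₀) = x₀ by omega, h₀] at this
  exact hx y₀ this.symm

/-- In a colouring of the rows and columns with at most two colours on any two consecutive
columns, in which no colour occurs in each of the first `n` columns, there are two colours such
that every row changes between them. -/
theorem exists_crossing {ι β : Type*} (g : ℕ → ι → β)
    (hg : ∀ x₁ x₂ x₃ y₁ y₂ y₃, x₁ ≤ x₂ + 1 → x₂ ≤ x₁ + 1 → x₂ ≤ x₃ + 1 → x₃ ≤ x₂ + 1 →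
      x₁ ≤ x₃ + 1 → x₃ ≤ x₁ + 1 →
      g x₁ y₁ = g x₂ y₂ ∨ g x₂ y₂ = g x₃ y₃ ∨ g x₁ y₁ = g x₃ y₃)
    (n : ℕ) (hn : ∀ A, ∃ x < n, ∀ y, g x y ≠ A) (y₀ : ι) :
    ∃ A B, A ≠ B ∧ ∀ y, ∃ z, (g z y = A ∧ g (z + 1) y = B) ∨ (g z y = B ∧ g (z + 1) y = A) := by
  by_cases hp : ∃ x₀, ∀ y, g x₀ y = g x₀ y₀
  · obtain ⟨x₀, hx₀⟩ := hp
    obtain ⟨x₁, -, hx₁⟩ := hn (g x₀ y₀)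
    rcases lt_trichotomy x₀ x₁ with h | h | h
    · obtain ⟨B, hAB, hB⟩ := exists_crossing_of_lt g hg h hx₀ hx₁ y₀
      exact ⟨_, B, hAB, fun y => (hB y).imp fun z => Or.inl⟩
    · subst h
      exact (hx₁ y₀ rfl).elim
    -- Mirror image; truncation repeats column 0, where no colour change can occur.
    · obtain ⟨B, hAB, hB⟩ := exists_crossing_of_lt (fun x => g (x₀ - x))
        (fun x₁ x₂ x₃ y₁ y₂ y₃ _ _ _ _ _ _ => hg _ _ _ y₁ y₂ y₃ (by omega) (by omega) (by omega)
          (by omega) (by omega) (by omega))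
        (A := g x₀ y₀) (x₀ := 0) (x₁ := x₀ - x₁) (by omega) (by simpa using hx₀)
        (by simpa [show x₀ - (x₀ - x₁) = x₁ by omega] using hx₁) y₀
      refine ⟨_, B, hAB, fun y => ?_⟩
      obtain ⟨z, hzA, hzB⟩ := hB y
      have hz : z < x₀ := by
        by_contra hz
        rw [show x₀ - (z + 1) = x₀ - z by omega] at hzB
        exact hAB (hzA.symm.trans hzB)
      refine ⟨x₀ - (z + 1), Or.inr ⟨hzB, ?_⟩⟩
      rwa [show x₀ - (z + 1) + 1 = x₀ - z by omega]
  -- With no monochromatic column, both colours of column 0 persist in every column, contradicting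
  -- `hn`.
  · push Not at hp
    obtain ⟨y₁, hy₁⟩ := hp 0
    have hall : ∀ x, (∃ y, g x y = g 0 y₀) ∧ ∃ y, g x y = g 0 y₁ := by
      intro x
      induction x with
      | zero => exact ⟨⟨_, rfl⟩, ⟨_, rfl⟩⟩
      | succ x ih =>
        obtain ⟨⟨a, ha⟩, b, hb⟩ := ih
        have key : ∀ y, g (x + 1) y = g 0 y₀ ∨ g (x + 1) y = g 0 y₁ := by
          intro y
          rcases hg x x (x + 1) a b y (by omega) (by omega) (by omega) (by omega) (by omega)
            (by omega) with h | h | h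
          · exact (hy₁ (by rw [← ha, ← hb, h])).elim
          · exact Or.inr (h.symm.trans hb)
          · exact Or.inl (h.symm.trans ha)
        obtain ⟨y, hy⟩ := hp (x + 1)
        rcases key y with h | h <;> rcases key y₀ with h' | h'
        · exact (hy (h.trans h'.symm)).elim
        · exact ⟨⟨_, h⟩, _, h'⟩
        · exact ⟨⟨_, h'⟩, _, h⟩
        · exact (hy (h.trans h'.symm)).elim
    obtain ⟨x, -, hx⟩ := hn (g 0 y₀)
    obtain ⟨y, hy⟩ := (hall x).1
    exact (hx y hy).elim

/-- If each triangle of the decorated thick path has two vertices with the same colour, then some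
colour class is large. -/
theorem mul_le_of_triangle_coloring {n k m w : ℕ} {β : Type*} [DecidableEq β] (hk : 1 ≤ k)
    (hn : w < n) (f : (Fin n × Fin k) ⊕ (Fin (n - 1) × Fin k × Fin m) → β)
    (hf : ∀ a b c, (decoratedThickPath n k m).Adj a b → (decoratedThickPath n k m).Adj b c →
      (decoratedThickPath n k m).Adj a c → f a = f b ∨ f b = f c ∨ f a = f c)
    (hw : ∀ A, #{v | f v = A} ≤ w) : k * (m + 1) ≤ 2 * w := by
  have : Nonempty (Fin k) := ⟨⟨0, hk⟩⟩
  -- Columns beyond the last repeat it, so a crossing can only be at a genuine edge (`hzn`).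
  let col : ℕ → Fin n := fun x => ⟨min x (n - 1), by omega⟩
  obtain ⟨A, B, hAB, hcross⟩ := exists_crossing (fun x y => f (Sum.inl (col x, y)))
    (by
      intro x₁ x₂ x₃ y₁ y₂ y₃ h1 h2 h3 h4 h5 h6
      by_cases e1 : (col x₁, y₁) = (col x₂, y₂)
      · left; rw [e1]
      by_cases e2 : (col x₂, y₂) = (col x₃, y₃)
      · right; left; rw [e2]
      by_cases e3 : (col x₁, y₁) = (col x₃, y₃)
      · right; right; rw [e3]
      refine hf _ _ _ ⟨e1, ?_, ?_⟩ ⟨e2, ?_, ?_⟩ ⟨e3, ?_, ?_⟩ <;> simp only [col] <;> omega)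
    n
    (by
      intro A
      -- A colour met in all `n` columns would have a class of size at least `n > w`.
      by_contra! hcon
      choose! r hr using hcon
      have h := card_le_card_of_injOn (s := (univ : Finset (Fin n))) (t := {v | f v = A})
        (fun x => Sum.inl (x, r x))
        (fun x _ => by
          have := hr x.val x.2
          simp only [col, show min x.val (n - 1) = x.val by omega] at this
          simpa using this)
        (fun x _ x' _ h => by
          simp only [Sum.inl.injEq, Prod.mk.injEq] at h
          exact h.1)
      have := hw A
      rw [card_univ, Fintype.card_fin] at h
      omega)
    (⟨0, hk⟩ : Fin k)
  choose z hz using hcross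
  have hzn : ∀ y, z y < n - 1 := by
    intro y
    by_contra hcon
    have hcol : col (z y + 1) = col (z y) := by
      simp only [col, Fin.mk.injEq]
      omega
    have := hz y
    rw [hcol] at this
    rcases this with ⟨h1, h2⟩ | ⟨h1, h2⟩
    · exact hAB (h1.symm.trans h2)
    · exact hAB (h2.symm.trans h1)
  have hcol0 : ∀ y, (col (z y)).val = z y := fun y => by
    have := hzn y
    simp only [col]
    omega
  have hcol1 : ∀ y, (col (z y + 1)).val = z y + 1 := fun y => by
    have := hzn y
    simp only [col]
    omega
  -- Per row, `none` is the left end of the crossing edge and `some j` its attached vertices.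
  let φ : Fin k × Option (Fin m) → (Fin n × Fin k) ⊕ (Fin (n - 1) × Fin k × Fin m) := fun p =>
    p.2.elim (Sum.inl (col (z p.1), p.1)) fun j => Sum.inr (⟨z p.1, hzn p.1⟩, p.1, j)
  have hφ : ∀ p, f (φ p) = A ∨ f (φ p) = B := by
    rintro ⟨y, _ | j⟩
    · exact (hz y).imp And.left And.left
    · have hadj : (decoratedThickPath n k m).Adj (Sum.inl (col (z y), y))
          (Sum.inl (col (z y + 1), y)) := by
        refine ⟨fun h => ?_, ?_, ?_⟩
        · have := congrArg (fun p => p.1.val) h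
          simp only [hcol0, hcol1] at this
          omega
        · simp only [hcol0, hcol1]; omega
        · simp only [hcol0, hcol1]; omega
      have h := hf (Sum.inl (col (z y), y)) (Sum.inl (col (z y + 1), y))
        (Sum.inr (⟨z y, hzn y⟩, y, j)) hadj ⟨rfl, Or.inr (hcol1 y)⟩ ⟨rfl, Or.inl (hcol0 y)⟩
      change f (Sum.inr (⟨z y, hzn y⟩, y, j)) = A ∨ f (Sum.inr (⟨z y, hzn y⟩, y, j)) = B
      rcases hz y with ⟨h1, h2⟩ | ⟨h1, h2⟩
      · rw [h1, h2] at h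
        rcases h with h | h | h
        · exact (hAB h).elim
        · exact Or.inr h.symm
        · exact Or.inl h.symm
      · rw [h1, h2] at h
        rcases h with h | h | h
        · exact (hAB h.symm).elim
        · exact Or.inl h.symm
        · exact Or.inr h.symm
  have hinj : Function.Injective φ := by
    rintro ⟨y, _ | j⟩ ⟨y', _ | j'⟩ h
    · simp only [φ, Option.elim_none, Sum.inl.injEq, Prod.mk.injEq] at h
      rw [h.2]
    · simp [φ] at h
    · simp [φ] at h
    · simp only [φ, Option.elim_some, Sum.inr.injEq, Prod.mk.injEq] at h
      rw [h.2.1, h.2.2]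
  have h := card_le_card_of_injOn (s := (univ : Finset (Fin k × Option (Fin m))))
    (t := univ.filter (fun v => f v = A) ∪ univ.filter (fun v => f v = B)) φ
    (fun p _ => by simpa using hφ p) hinj.injOn
  have h1 := card_union_le (univ.filter fun v => f v = A) (univ.filter fun v => f v = B)
  have h2 := hw A
  have h3 := hw B
  simp only [card_univ, Fintype.card_prod, Fintype.card_fin, Fintype.card_option] at h
  omega

/-! ### Tree-partitions. -/

/-- Each triangle has two vertices in a common bag of a tree-partition. -/
theorem IsTreePartition.part_eq_of_triangle {V : Type*} [Fintype V] [DecidableEq V]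
    {G : SimpleGraph V} {P : Finpartition (univ : Finset V)} (hP : IsTreePartition G P) {a b c : V}
    (hab : G.Adj a b) (hbc : G.Adj b c) (hac : G.Adj a c) :
    P.part a = P.part b ∨ P.part b = P.part c ∨ P.part a = P.part c := by
  by_contra! hcon
  obtain ⟨h1, h2, h3⟩ := hcon
  let q : V → {B : Finset V // B ∈ P.parts} := fun v => ⟨P.part v, P.part_mem.2 (mem_univ v)⟩
  have hadj : ∀ u v, G.Adj u v → P.part u ≠ P.part v → (quotientGraph G P).Adj (q u) (q v) :=
    fun u v huv hne => ⟨fun h => hne (congrArg Subtype.val h), u, P.mem_part_self.2 (mem_univ u), v,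
      P.mem_part_self.2 (mem_univ v), huv⟩
  exact SimpleGraph.IsAcyclic.cliqueFree hP le_rfl _ (SimpleGraph.is3Clique_iff.2
    ⟨_, _, _, hadj a b hab h1, hadj a c hac h3, hadj b c hbc h2, rfl⟩)

theorem exists_isTreePartition {V : Type*} [Fintype V] [DecidableEq V] (G : SimpleGraph V) :
    ∃ P : Finpartition (univ : Finset V), IsTreePartition G P := by
  classical
  refine ⟨⊤, ?_⟩
  have : Subsingleton {B : Finset V // B ∈ (⊤ : Finpartition (univ : Finset V)).parts} :=
    ⟨fun A B => Subtype.ext (Finpartition.parts_top_subsingleton _ A.2 B.2)⟩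
  exact SimpleGraph.IsAcyclic.of_subsingleton

theorem mul_le_two_mul_treePartitionWidth {V : Type*} [Fintype V] [DecidableEq V] {n k m : ℕ}
    {G : SimpleGraph V} (e : G ≃g decoratedThickPath n k m) (hk : 1 ≤ k)
    (hn : k * (m + 1) ≤ 2 * n) : k * (m + 1) ≤ 2 * treePartitionWidth G := by
  obtain ⟨P, hP, hw⟩ : treePartitionWidth G ∈
      {w : ℕ | ∃ P : Finpartition (univ : Finset V), IsTreePartition G P ∧ width P = w} :=
    Nat.sInf_mem ((exists_isTreePartition G).elim fun P hP => ⟨_, P, hP, rfl⟩)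
  rcases lt_or_ge (treePartitionWidth G) n with hlt | hge
  · refine mul_le_of_triangle_coloring hk hlt (fun v => P.part (e.symm v))
      (fun a b c hab hbc hac => hP.part_eq_of_triangle (e.symm.map_rel_iff.2 hab)
        (e.symm.map_rel_iff.2 hbc) (e.symm.map_rel_iff.2 hac)) fun A => ?_
    by_cases hA : A ∈ P.parts
    · calc _ ≤ #A := card_le_card_of_injOn e.symm
            (fun v hv => by
              simp only [coe_filter, mem_univ, true_and, Set.mem_ofPred_eq] at hv
              rw [← hv]
              exact P.mem_part_self.2 (mem_univ _))
            e.symm.injective.injOn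
        _ ≤ width P := le_sup (f := Finset.card) hA
        _ = _ := hw
    · rw [filter_false_of_mem, card_empty]
      · exact Nat.zero_le _
      · rintro v - rfl
        exact hA (P.part_mem.2 (mem_univ _))
  · omega

end TreePartition

theorem mainTheorem4 (k Δ : ℕ) (hk : 2 ≤ k) (hΔ : 3 * k + 1 ≤ Δ) :
    {N : ℕ | ∃ (G : SimpleGraph (Fin N)) (_ : DecidableRel G.Adj),
      TreePartition.IsChordal G ∧
      TreePartition.treewidth G = 2 * k - 1 ∧
      G.maxDegree ≤ Δ ∧
      (1 / 4 : ℝ) * (k : ℝ) * ((Δ : ℝ) - 3 * (k : ℝ)) <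
        (TreePartition.treePartitionWidth G : ℝ) ∧
      ∃ n : ℕ, Nonempty (G ≃g
        TreePartition.decoratedThickPath n k ⌈((Δ : ℝ) - 3 * (k : ℝ)) / 2⌉₊)}.Infinite := by
  classical
  have hΔ' : (3 * k + 1 : ℝ) ≤ Δ := by exact_mod_cast hΔ
  have hm1 : ((Δ : ℝ) - 3 * k) / 2 ≤ (⌈((Δ : ℝ) - 3 * (k : ℝ)) / 2⌉₊ : ℝ) := Nat.le_ceil _
  -- Rounding up costs at most one in `2 * m`, absorbed by the `- 1` of the degree bound.
  have hm2 : 3 * k - 1 + 2 * ⌈((Δ : ℝ) - 3 * (k : ℝ)) / 2⌉₊ ≤ Δ := by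
    suffices 2 * ⌈((Δ : ℝ) - 3 * (k : ℝ)) / 2⌉₊ < Δ - 3 * k + 2 by omega
    have h := Nat.ceil_lt_add_one (a := ((Δ : ℝ) - 3 * k) / 2) (by linarith)
    rw [← Nat.cast_lt (α := ℝ)]
    push_cast [Nat.cast_sub (show 3 * k ≤ Δ by omega)]
    linarith
  generalize ⌈((Δ : ℝ) - 3 * (k : ℝ)) / 2⌉₊ = m at hm1 hm2 ⊢
  refine Set.infinite_of_not_bddAbove ?_
  rintro ⟨M, hM⟩
  -- The summands serve the width bound, the excess over `M` vertices, and the clique on two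
  -- columns.
  let n := k * (m + 1) + M + 2
  let V := (Fin n × Fin k) ⊕ (Fin (n - 1) × Fin k × Fin m)
  let G := (TreePartition.decoratedThickPath n k m).comap (Fintype.equivFin V).symm
  let e : G ≃g TreePartition.decoratedThickPath n k m :=
    SimpleGraph.Iso.comap (Fintype.equivFin V).symm _
  have hG : TreePartition.IsChordal G :=
    (TreePartition.isChordal_decoratedThickPath n k m).of_embedding e.toEmbedding
  have hcard : n * k + (n - 1) * (k * m) = Fintype.card V := by simp [V]
  have hle : Fintype.card V ≤ M := by
    refine hM ⟨G, Classical.decRel _, hG, ?_, ?_, ?_, n, ⟨e⟩⟩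
    · refine TreePartition.treewidth_eq_of_isChordal hG ?_ ?_
      · rw [show 2 * k - 1 + 2 = 2 * k + 1 by omega]
        exact (TreePartition.cliqueFree_decoratedThickPath hk).comap ⟨e.toCopy⟩
      · rw [show 2 * k - 1 + 1 = 2 * k by omega]
        exact fun h => TreePartition.not_cliqueFree_decoratedThickPath (by omega)
          (h.comap ⟨e.symm.toCopy⟩)
    · refine SimpleGraph.maxDegree_le_of_forall_degree_le _ _ fun v => ?_
      rw [← e.degree_eq]
      exact (TreePartition.degree_decoratedThickPath_le (by omega) _).trans hm2
    · have h := TreePartition.mul_le_two_mul_treePartitionWidth e (by omega)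
        (by simp only [n]; omega)
      have h' : (k : ℝ) * (m + 1) ≤ 2 * TreePartition.treePartitionWidth G := by exact_mod_cast h
      have hk0 : (0 : ℝ) < k := by exact_mod_cast (by omega : 0 < k)
      -- The `+ 1` in `m + 1` makes the inequality strict.
      nlinarith [mul_le_mul_of_nonneg_left hm1 hk0.le]
  have : n ≤ n * k := Nat.le_mul_of_pos_right n (by omega)
  simp only [n] at *
  omega
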